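/- Let $E$ be a finite-dimensional Euclidean space and $d\ge 0$ an integer. Equip $\bigwedge^d E$ with the inner product $\langle v_1\wedge\dots\wedge v_d, w_1\wedge\dots\wedge w_d\rangle=\det(\langle v_i,w_j\rangle)_{i,j}$, and let $\Omega_0^d(E)=C_0(E,\bigwedge^d E^*)$ be the Banach space of continuous $d$-forms vanishing at infinity, with the supremum norm; $d$-currents are the elements of its dual $\Omega_0^d(E)'$. A $d$-dimensional rectifiable set is an $\mathcal H^d$-measurable set $X\subset E$ with $\mathcal H^d(X)<\infty$ which, up to an $\mathcal H^d$-null set, is covered by countably many Lipschitz images of $\mathbb R^d$. An orientation of $X$ is an $\mathcal H^d$-measurable map $\tau$ from $X$ to $\bigwedge^d E$ such that for $\mathcal H^d$-almost every $x\in X$ one has $\tau(x)=e_1\wedge\dots\wedge e_d$ for some orthonormal basis $(e_1,\dots,e_d)$ of the approximate tangent space $T_xX$. The rectifiable current associated to the oriented set $X$ is $$C_X(\omega)=\int_X\omega=\int_X \omega_x(\tau(x))\,d\mathcal H^d(x),\qquad \omega\in\Omega_0^d(E).$$ Let $K:E\times E\to\mathcal L(\bigwedge^d E)$ be a positive (semidefinite)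 operator-valued kernel that is bounded and such that, for all $y\in E$ and $\xi\in\bigwedge^d E$, the function $x\mapsto K(x,y)\xi$ is continuous and vanishes at infinity. Let $W$ be its reproducing kernel Hilbert space of functions $E\to\bigwedge^d E$; identifying $w\in W$ with the $d$-form $x\mapsto\langle w(x),\cdot\rangle$, one has a continuous inclusion $W\hookrightarrow\Omega_0^d(E)$. For a current $T$, let $\|T\|_{W'}$ be the norm of the restriction $T|_W$ in the dual Hilbert space $W'$. Then there is a constant $C\ge 0$, depending only on the kernel $K$, such that for every oriented $d$-dimensional rectifiable set $X\subset E$, $$\|C_X\|_{W'}\le C\,\mathcal H^d(X).$$ -/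

import Mathlib

open MeasureTheory Filter Topology Set
open scoped ZeroAtInfty CompactlySupported

/-! ### Multivectors -/

section MultiVector

variable (E : Type*) [NormedAddCommGroup E] [InnerProductSpace ℝ E] [FiniteDimensional ℝ E] (d : ℕ)

/-- The space `⋀^d E` of `d`-vectors, as a Euclidean space: it carries Mathlib's inner product
`⟪v₁ ∧ ⋯ ∧ v_d, w₁ ∧ ⋯ ∧ w_d⟫ = det (⟪vᵢ, wⱼ⟫)`. (A separate name makes its algebraic structure
be found through its norm.) -/
def MultiVector : Type _ := ⋀[ℝ]^d E

noncomputable instance : NormedAddCommGroup (MultiVector E d) :=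
  inferInstanceAs (NormedAddCommGroup (⋀[ℝ]^d E))

noncomputable instance : InnerProductSpace ℝ (MultiVector E d) :=
  inferInstanceAs (InnerProductSpace ℝ (⋀[ℝ]^d E))

instance : FiniteDimensional ℝ (MultiVector E d) :=
  inferInstanceAs (Module.Finite ℝ (⋀[ℝ]^d E))

instance : CompleteSpace (MultiVector E d) := FiniteDimensional.complete ℝ _

variable {E d}

/-- The simple `d`-vector `v₁ ∧ ⋯ ∧ v_d`. -/
noncomputable def wedge (v : Fin d → E) : MultiVector E d := exteriorPower.ιMulti ℝ d v

theorem inner_wedge_wedge (v w : Fin d → E) :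
    inner ℝ (wedge v) (wedge w) = Matrix.det (Matrix.of fun i j => inner ℝ (v i) (w j)) := by
  rw [← Matrix.det_transpose]
  exact exteriorPower.inner_ιMulti_ιMulti v w

theorem norm_wedge_of_orthonormal {e : Fin d → E} (he : Orthonormal ℝ e) : ‖wedge e‖ = 1 := by
  have h : inner ℝ (wedge e) (wedge e) = 1 := by
    rw [inner_wedge_wedge, ← Matrix.det_one (R := ℝ) (n := Fin d)]
    congr 1
    ext i j
    rw [Matrix.of_apply, orthonormal_iff_ite.mp he i j, Matrix.one_apply]
  rw [real_inner_self_eq_norm_sq] at h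
  exact (pow_eq_one_iff_of_nonneg (norm_nonneg _) two_ne_zero).mp h

variable (E d) in
/-- The space `⋀^d E*` of `d`-covectors: linear forms on `⋀^d E`, with the dual norm. (Again a
separate name, for the sake of instances.) -/
def Covector : Type _ := StrongDual ℝ (MultiVector E d)

noncomputable instance : NormedAddCommGroup (Covector E d) :=
  inferInstanceAs (NormedAddCommGroup (StrongDual ℝ (MultiVector E d)))

noncomputable instance : NormedSpace ℝ (Covector E d) :=
  inferInstanceAs (NormedSpace ℝ (StrongDual ℝ (MultiVector E d)))

noncomputable instance : FunLike (Covector E d) (MultiVector E d) ℝ :=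
  inferInstanceAs (FunLike (StrongDual ℝ (MultiVector E d)) (MultiVector E d) ℝ)

/-- The tautological map from covectors to linear forms on `⋀^d E`. -/
noncomputable def Covector.toDual : Covector E d →L[ℝ] StrongDual ℝ (MultiVector E d) :=
  ContinuousLinearMap.id ℝ (StrongDual ℝ (MultiVector E d))

theorem Covector.toDual_apply (φ : Covector E d) (ξ : MultiVector E d) :
    Covector.toDual φ ξ = φ ξ := rfl

theorem Covector.norm_apply_le (φ : Covector E d) (ξ : MultiVector E d) :
    ‖φ ξ‖ ≤ ‖φ‖ * ‖ξ‖ :=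
  ContinuousLinearMap.le_opNorm (E := MultiVector E d) (F := ℝ) φ ξ

/-- The covector `⟨ξ, ·⟩`, linearly in `ξ`. -/
noncomputable def Covector.ofMultiVector : MultiVector E d →L[ℝ] Covector E d :=
  (innerSL ℝ : MultiVector E d →L[ℝ] StrongDual ℝ (MultiVector E d))

theorem Covector.ofMultiVector_apply (ξ η : MultiVector E d) :
    Covector.ofMultiVector ξ η = inner ℝ ξ η := rfl

theorem Covector.norm_ofMultiVector (ξ : MultiVector E d) : ‖Covector.ofMultiVector ξ‖ = ‖ξ‖ :=
  innerSL_apply_norm ℝ ξ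

end MultiVector

/-! ### Differential forms and currents -/

/-- `Ω₀^d(E) = C₀(E, ⋀^d E*)`: continuous differential forms of degree `d` on `E` vanishing at
infinity, with the supremum norm. -/
abbrev ZeroForm (E : Type*) [NormedAddCommGroup E] [InnerProductSpace ℝ E]
    [FiniteDimensional ℝ E] (d : ℕ) : Type _ :=
  C₀(E, Covector E d)

/-- `d`-currents on `E`: the continuous linear forms on `Ω₀^d(E)`. -/
abbrev Current (E : Type*) [NormedAddCommGroup E] [InnerProductSpace ℝ E]
    [FiniteDimensional ℝ E] (d : ℕ) : Type _ :=
  StrongDual ℝ (ZeroForm E d)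

/-! ### Rectifiable sets, approximate tangent spaces, orientations -/

section Rectifiable

variable {E : Type*} [NormedAddCommGroup E] [InnerProductSpace ℝ E]
  [MeasurableSpace E] [BorelSpace E]

/-- `d`-dimensional rectifiable sets: `ℋ^d`-measurable sets of finite `ℋ^d`-measure which, up to
an `ℋ^d`-null set, are covered by countably many Lipschitz images of `ℝ^d`. -/
structure IsRectifiableSet (d : ℕ) (X : Set E) : Prop where
  nullMeasurableSet : NullMeasurableSet X μHE[d]
  measure_lt_top : μHE[d] X < ⊤
  exists_cover : ∃ f : ℕ → EuclideanSpace ℝ (Fin d) → E,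
    (∀ i, ∃ L, LipschitzWith L (f i)) ∧ μHE[d] (X \ ⋃ i, range (f i)) = 0

/-- The `d`-dimensional linear subspace `P` is the approximate tangent space of `X` at `x`: the
measures `ℋ^d` restricted to the dilations `(X - x) / r` converge to `ℋ^d` restricted to `P`, in
duality with compactly supported continuous functions, as `r → 0⁺`. -/
def IsApproxTangentSpace (d : ℕ) (X : Set E) (x : E) (P : Submodule ℝ E) : Prop :=
  Module.finrank ℝ P = d ∧
    ∀ f : C_c(E, ℝ),
      Tendsto (fun r : ℝ => (r ^ d)⁻¹ * ∫ y in X, f (r⁻¹ • (y - x)) ∂μHE[d]) (𝓝[>] 0)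
        (𝓝 (∫ y in (P : Set E), f y ∂μHE[d]))

variable [FiniteDimensional ℝ E]

/-- `τ` is an orientation of `X`: an `ℋ^d`-measurable field of `d`-vectors such that, for
`ℋ^d`-almost every `x ∈ X`, `τ x = e₁ ∧ ⋯ ∧ e_d` for some orthonormal basis `(e₁, …, e_d)` of the
approximate tangent space of `X` at `x`. (The values of `τ` outside `X` are irrelevant.) -/
structure IsOrientation (d : ℕ) (X : Set E) (τ : E → MultiVector E d) : Prop where
  aestronglyMeasurable : AEStronglyMeasurable τ (μHE[d].restrict X)
  ae_tangent : ∀ᵐ x ∂(μHE[d].restrict X), ∃ P : Submodule ℝ E, IsApproxTangentSpace d X x P ∧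
    ∃ e : Fin d → E, Orthonormal ℝ e ∧ Submodule.span ℝ (range e) = P ∧
      τ x = wedge e

end Rectifiable

/-- A `d`-dimensional rectifiable subset of `E` together with an orientation. -/
structure OrientedRectifiableSet (E : Type*) [NormedAddCommGroup E] [InnerProductSpace ℝ E]
    [FiniteDimensional ℝ E] [MeasurableSpace E] [BorelSpace E] (d : ℕ) where
  /-- the underlying set -/
  carrier : Set E
  /-- the field of unit tangent `d`-vectors -/
  orientation : E → MultiVector E d
  isRectifiableSet : IsRectifiableSet d carrier
  isOrientation : IsOrientation d carrier orientation

namespace OrientedRectifiableSet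

variable {E : Type*} [NormedAddCommGroup E] [InnerProductSpace ℝ E] [FiniteDimensional ℝ E]
  [MeasurableSpace E] [BorelSpace E] {d : ℕ}

theorem ae_norm_orientation (X : OrientedRectifiableSet E d) :
    ∀ᵐ x ∂(μHE[d].restrict X.carrier), ‖X.orientation x‖ = 1 := by
  filter_upwards [X.isOrientation.ae_tangent] with x hx
  obtain ⟨P, -, e, he, -, hτ⟩ := hx
  rw [hτ, norm_wedge_of_orthonormal he]

theorem isFiniteMeasure (X : OrientedRectifiableSet E d) :
    IsFiniteMeasure ((μHE[d] : Measure E).restrict X.carrier) :=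
  ⟨by simpa using X.isRectifiableSet.measure_lt_top⟩

theorem integrable (X : OrientedRectifiableSet E d) (ω : ZeroForm E d) :
    Integrable (fun x => ω x (X.orientation x)) (μHE[d].restrict X.carrier) := by
  have := X.isFiniteMeasure
  have hω : AEStronglyMeasurable (fun x => ω x)
      ((μHE[d] : Measure E).restrict X.carrier) :=
    (map_continuous ω).aestronglyMeasurable
  refine Integrable.of_bound
    (Covector.toDual.aestronglyMeasurable_comp₂ hω
      X.isOrientation.aestronglyMeasurable) ‖ω‖ ?_
  filter_upwards [X.ae_norm_orientation] with x hx
  calc ‖ω x (X.orientation x)‖ ≤ ‖ω x‖ * ‖X.orientation x‖ := (ω x).norm_apply_le _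
    _ = ‖ω.toBCF x‖ := by rw [hx, mul_one]; rfl
    _ ≤ ‖ω‖ := ω.toBCF.norm_coe_le_norm x

/-- The rectifiable current `C_X : ω ↦ ∫_X ω = ∫_X ω_x(τ(x)) dℋ^d(x)` associated to the
oriented rectifiable set `X`. -/
noncomputable def current (X : OrientedRectifiableSet E d) : Current E d :=
  LinearMap.mkContinuousOfExistsBound
    { toFun := fun ω => ∫ x in X.carrier, ω x (X.orientation x) ∂μHE[d]
      map_add' := fun ω η => integral_add (X.integrable ω) (X.integrable η)
      map_smul' := fun c ω => integral_const_mul c _ }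
    ⟨(μHE[d] : Measure E).real X.carrier, fun ω => by
      have := X.isFiniteMeasure
      rw [mul_comm, ← measureReal_restrict_apply_univ]
      refine norm_integral_le_of_norm_le_const ?_
      filter_upwards [X.ae_norm_orientation] with x hx
      calc ‖ω x (X.orientation x)‖ ≤ ‖ω x‖ * ‖X.orientation x‖ := (ω x).norm_apply_le _
        _ = ‖ω.toBCF x‖ := by rw [hx, mul_one]; rfl
        _ ≤ ‖ω‖ := ω.toBCF.norm_coe_le_norm x⟩

theorem current_apply (X : OrientedRectifiableSet E d) (ω : ZeroForm E d) :
    X.current ω = ∫ x in X.carrier, ω x (X.orientation x) ∂μHE[d] := rfl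

end OrientedRectifiableSet

/-! ### Kernels and their reproducing kernel Hilbert spaces -/

/-- Regularity of an operator-valued kernel: it is bounded, and all the functions `K(·, y) v` are
continuous and vanish at infinity. -/
structure IsC0Kernel {E V : Type*} [TopologicalSpace E] [NormedAddCommGroup V]
    [InnerProductSpace ℝ V] (K : Matrix E E (V →L[ℝ] V)) : Prop where
  continuous : ∀ y v, Continuous fun x => K x y v
  zero_at_infty : ∀ y v, Tendsto (fun x => K x y v) (cocompact E) (𝓝 0)
  bounded : ∃ B : ℝ, ∀ x y, ‖K x y‖ ≤ B

section Embedding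

variable {E V H : Type*} [TopologicalSpace E] [NormedAddCommGroup V] [InnerProductSpace ℝ V]
  [CompleteSpace V] [NormedAddCommGroup H] [InnerProductSpace ℝ H] [CompleteSpace H] [RKHS ℝ H E V]

theorem IsC0Kernel.exists_bound (hK : IsC0Kernel (RKHS.kernel H)) :
    ∃ C : ℝ, 0 ≤ C ∧ ∀ (f : H) (x : E), ‖f x‖ ≤ C * ‖f‖ := by
  obtain ⟨B, hB⟩ := hK.bounded
  refine ⟨√B, Real.sqrt_nonneg _, fun f x => (RKHS.norm_apply_le f x).trans ?_⟩
  rw [mul_comm]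
  gcongr
  exact hB x x

theorem IsC0Kernel.mem_C0 (hK : IsC0Kernel (RKHS.kernel H)) (f : H) :
    Continuous f ∧ Tendsto f (cocompact E) (𝓝 0) := by
  obtain ⟨C, hC0, hC⟩ := hK.exists_bound
  let S : Submodule ℝ H :=
    { carrier := {g | Continuous g ∧ Tendsto g (cocompact E) (𝓝 0)}
      add_mem' := fun {a b} ha hb => by
        refine ⟨?_, ?_⟩
        · rw [RKHS.coe_add]; exact ha.1.add hb.1
        · rw [RKHS.coe_add]; simpa using! ha.2.add hb.2
      zero_mem' := by
        refine ⟨?_, ?_⟩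
        · rw [RKHS.coe_zero]; exact continuous_zero
        · rw [RKHS.coe_zero]; exact tendsto_const_nhds
      smul_mem' := fun c a ha => by
        refine ⟨?_, ?_⟩
        · rw [RKHS.coe_smul]; exact ha.1.const_smul c
        · rw [RKHS.coe_smul]; simpa using! ha.2.const_smul c }
  have hsub : Submodule.span ℝ {RKHS.kerFun H x v | (x : E) (v : V)} ≤ S := by
    refine Submodule.span_le.mpr ?_
    rintro _ ⟨y, v, rfl⟩
    have h : (RKHS.kerFun H y v : E → V) = fun x => RKHS.kernel H x y v :=
      funext fun x => RKHS.kerFun_apply H y v x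
    refine ⟨?_, ?_⟩
    · rw [h]; exact hK.continuous y v
    · rw [h]; exact hK.zero_at_infty y v
  have hcl : f ∈ closure (S : Set H) := by
    have : f ∈ (Submodule.span ℝ {RKHS.kerFun H x v | (x : E) (v : V)}).topologicalClosure := by
      rw [RKHS.kerFun_dense]; trivial
    exact closure_mono hsub this
  have happrox : ∀ ε > 0, ∃ g ∈ S, ∀ x, ‖f x - g x‖ < ε := by
    intro ε hε
    obtain ⟨g, hg, hfg⟩ := Metric.mem_closure_iff.mp hcl (ε / (C + 1)) (by positivity)
    refine ⟨g, hg, fun x => ?_⟩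
    rw [dist_eq_norm] at hfg
    calc ‖f x - g x‖ = ‖(f - g) x‖ := by rw [RKHS.coe_sub]; rfl
      _ ≤ C * ‖f - g‖ := hC _ x
      _ ≤ (C + 1) * ‖f - g‖ := by gcongr; linarith
      _ < (C + 1) * (ε / (C + 1)) := by gcongr
      _ = ε := by field_simp
  constructor
  · refine continuous_of_uniform_approx_of_continuous fun u hu => ?_
    obtain ⟨ε, hε, hu⟩ := Metric.mem_uniformity_dist.mp hu
    obtain ⟨g, hg, h⟩ := happrox ε hε
    exact ⟨g, hg.1, fun x => hu (by rw [dist_eq_norm]; exact h x)⟩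
  · rw [Metric.tendsto_nhds]
    intro ε hε
    obtain ⟨g, hg, h⟩ := happrox (ε / 2) (half_pos hε)
    filter_upwards [Metric.tendsto_nhds.mp hg.2 (ε / 2) (half_pos hε)] with x hx
    rw [dist_zero_right] at hx ⊢
    calc ‖f x‖ = ‖(f x - g x) + g x‖ := by rw [sub_add_cancel]
      _ ≤ ‖f x - g x‖ + ‖g x‖ := norm_add_le _ _
      _ < ε := by linarith [h x]

end Embedding

section KernelNorm

variable {E : Type*} [NormedAddCommGroup E] [InnerProductSpace ℝ E] [FiniteDimensional ℝ E]
  {d : ℕ} (K : Matrix E E ((MultiVector E d) →L[ℝ] (MultiVector E d))) [Fact K.PosSemidef]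

theorem IsC0Kernel.kernel_ofKernel {K : Matrix E E (MultiVector E d →L[ℝ] MultiVector E d)}
    [Fact K.PosSemidef] (hK : IsC0Kernel K) : IsC0Kernel (RKHS.kernel (RKHS.OfKernel K)) := by
  rwa [RKHS.OfKernel.kernel_ofKernel]

/-- The inclusion `W ↪ Ω₀^d(E)` of the reproducing kernel Hilbert space `W` of `K`: a function
`w : E → ⋀^d E` in `W` is the differential form `x ↦ ⟨w(x), ·⟩`. -/
noncomputable def kernelInclusion (hK : IsC0Kernel K) : RKHS.OfKernel K →L[ℝ] ZeroForm E d :=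
  LinearMap.mkContinuousOfExistsBound
    { toFun := fun w =>
        { toFun := fun x => Covector.ofMultiVector (w x)
          continuous_toFun :=
            (Covector.ofMultiVector (E := E) (d := d)).continuous.comp
              (hK.kernel_ofKernel.mem_C0 w).1
          zero_at_infty' := by
            have h := ((Covector.ofMultiVector (E := E) (d := d)).continuous.tendsto 0).comp
              (hK.kernel_ofKernel.mem_C0 w).2
            rwa [map_zero] at h }
      map_add' := fun w z => by
        ext1 x
        simp
      map_smul' := fun c w => by
        ext1 x
        simp }
    (by
      obtain ⟨C, hC0, hC⟩ := hK.kernel_ofKernel.exists_bound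
      refine ⟨C, fun w => ?_⟩
      refine (BoundedContinuousFunction.norm_le (by positivity)).mpr fun x => ?_
      exact (Covector.norm_ofMultiVector (w x)).le.trans (hC w x))

/-- On the reproducing kernel Hilbert space of `K`, the form `kernelInclusion K hK w` is
`x ↦ ⟨w(x), ·⟩`. -/
theorem kernelInclusion_apply (hK : IsC0Kernel K) (w : RKHS.OfKernel K) (x : E) (ξ : MultiVector E d) :
    kernelInclusion K hK w x ξ = inner ℝ (w x) ξ := rfl

/-- The kernel norm `‖T‖_{W'}` of a current `T`: the norm, in the dual `W'` of the reproducing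
kernel Hilbert space `W` of `K`, of the restriction of `T` to `W`. -/
noncomputable def kernelDualNorm (hK : IsC0Kernel K) (T : Current E d) : ℝ :=
  ‖(T.comp (kernelInclusion K hK) : StrongDual ℝ (RKHS.OfKernel K))‖

end KernelNorm

/-! The estimate factors through the mass norm, the dual norm on `Ω₀^d(E)'`. The orientation is
almost everywhere a wedge of orthonormal vectors, hence a unit `d`-vector by the Gram determinant,
so the integrand `ω_x(τ(x))` never exceeds `‖ω‖` and integration over `X` costs only the factor
`ℋ^d(X)`: this is `norm_current_le`. Restricting a current to `W` means composing it with the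
continuous inclusion `W ↪ Ω₀^d(E)`, so the kernel norm is at most the mass times the norm of that
inclusion (`kernelDualNorm_le`). The inclusion depends on `K` alone, which makes the constant
uniform in `X`. -/

/-- The mass of the current of an oriented rectifiable set is at most the measure of the set. -/
theorem OrientedRectifiableSet.norm_current_le {E : Type*} [NormedAddCommGroup E]
    [InnerProductSpace ℝ E] [FiniteDimensional ℝ E] [MeasurableSpace E] [BorelSpace E] {d : ℕ}
    (X : OrientedRectifiableSet E d) :
    ‖X.current‖ ≤ (μHE[d] : Measure E).real X.carrier := by
  refine ContinuousLinearMap.opNorm_le_bound _ measureReal_nonneg fun ω => ?_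
  -- Finiteness is essential to the form of the bound: `Measure.real` would send an infinite measure
  -- to `0`.
  have := X.isFiniteMeasure
  -- The area of `X` becomes the total mass of the restricted measure, so that a pointwise almost
  -- everywhere bound of the integrand by `‖ω‖` suffices.
  rw [X.current_apply, mul_comm, ← measureReal_restrict_apply_univ]
  refine norm_integral_le_of_norm_le_const ?_
  filter_upwards [X.ae_norm_orientation] with x hx
  calc ‖ω x (X.orientation x)‖ ≤ ‖ω x‖ * ‖X.orientation x‖ := (ω x).norm_apply_le _
    _ = ‖ω.toBCF x‖ := by rw [hx, mul_one]; rfl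
    _ ≤ ‖ω‖ := ω.toBCF.norm_coe_le_norm x

/-- The kernel norm of a current is at most the norm of the inclusion times its mass. -/
theorem kernelDualNorm_le {E : Type*} [NormedAddCommGroup E] [InnerProductSpace ℝ E]
    [FiniteDimensional ℝ E] {d : ℕ}
    (K : Matrix E E (MultiVector E d →L[ℝ] MultiVector E d)) [Fact K.PosSemidef]
    (hK : IsC0Kernel K) (T : Current E d) :
    kernelDualNorm K hK T ≤ ‖kernelInclusion K hK‖ * ‖T‖ := by
  rw [mul_comm]
  -- The kernel norm is by definition the operator norm of a composite, so submultiplicativity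
  -- applies.
  exact ContinuousLinearMap.opNorm_comp_le T (kernelInclusion K hK)

theorem mainTheorem8 {E : Type*} [NormedAddCommGroup E] [InnerProductSpace ℝ E]
    [FiniteDimensional ℝ E] [MeasurableSpace E] [BorelSpace E] {d : ℕ}
    (K : Matrix E E (MultiVector E d →L[ℝ] MultiVector E d)) [Fact K.PosSemidef] (hK : IsC0Kernel K) :
    ∃ C : ℝ, 0 ≤ C ∧ ∀ X : OrientedRectifiableSet E d,
      kernelDualNorm K hK X.current ≤ C * (μHE[d] : Measure E).real X.carrier :=
  -- The constant is fixed before `X`. By the reproducing property it is at most `√B` for any bound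
  -- `B` of `‖K x y‖`, so boundedness of the kernel is what makes it finite.
  ⟨‖kernelInclusion K hK‖, ContinuousLinearMap.opNorm_nonneg _, fun X =>
    (kernelDualNorm_le K hK X.current).trans <|
      mul_le_mul_of_nonneg_left X.norm_current_le (ContinuousLinearMap.opNorm_nonneg _)⟩
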